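/- Let $G=(\mathcal V,\mathcal E)$ be a finite undirected graph with $V=|\mathcal V|$ vertices. For an edge-weight function $w:\mathcal E\to[0,\infty)$ and vertices $u,v$ joined by a path, let $d_w(u,v)$ be the minimum, over all paths $P$ from $u$ to $v$, of $w(P)=\sum_{e\in P}w(e)$. Two weight functions $w,w'$ are neighboring if $\sum_{e\in\mathcal E}|w(e)-w'(e)|\le 1$. A randomized algorithm $\mathcal A$ taking weight functions $w:\mathcal E\to[0,\infty)$ as input is $(\epsilon,\delta)$-differentially private on $G$ if $\Pr[\mathcal A(w)\in S]\le e^{\epsilon}\Pr[\mathcal A(w')\in S]+\delta$ for all neighboring $w,w'$ and all (measurable) sets $S$ of outputs; it is $\epsilon$-differentially private if this holds with $\delta=0$. Here the output of an algorithm is a table $(a_{u,v})_{u,v\in\mathcal V}$ of real numbers. For every $c>1$ there is a constant $C>0$, depending only on $c$, such that the following hold. (1) For every finite undirected graph $G$ and all real $\epsilon\in(0,1)$, $\delta\in(0,1/c]$, $\gamma\in(0,1)$ and $\Lambda$ with $1/V<\Lambda\epsilon<V$ and $V\Lambda\epsilon/\gamma\ge c$, there is an $(\epsilon,\delta)$-differentially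 private algorithm $\mathcal A$ on $G$ such that for every $w:\mathcal E\to[0,\Lambda]$, with probability at least $1-\gamma$ the output $a$ of $\mathcal A(w)$ satisfies, simultaneously for all pairs $u,v$ joined by a path in $G$ (that is, for all pairs of vertices if $G$ is connected), $$|a_{u,v}-d_w(u,v)|\le C\,\sqrt{V\Lambda\epsilon^{-1}\log(1/\delta)}\;\log(V\Lambda\epsilon/\gamma).$$ (2) For every finite undirected graph $G$ and all real $\epsilon>0$, $\gamma\in(0,1)$ and $\Lambda$ with $1/V<\Lambda\epsilon<V^2$ and $V\Lambda\epsilon/\gamma\ge c$, there is an $\epsilon$-differentially private algorithm $\mathcal B$ on $G$ such that for every $w:\mathcal E\to[0,\Lambda]$, with probability at least $1-\gamma$ the output $a$ of $\mathcal B(w)$ satisfies, simultaneously for all pairs $u,v$ joined by a path in $G$, $$|a_{u,v}-d_w(u,v)|\le C\,(V\Lambda)^{2/3}\epsilon^{-1/3}\,\log(V\Lambda\epsilon/\gamma).$$ -/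

import Mathlib

open scoped NNReal

/-- The weight `w(P) = ∑_{e ∈ P} w(e)` of a walk, for edge weights `w : E → [0, ∞)`. -/
def walkWeight {V : Type*} {G : SimpleGraph V} (w : G.edgeSet → ℝ≥0) :
    {u v : V} → G.Walk u v → ℝ
  | _, _, .nil => 0
  | _, _, .cons (u := a) (v := b) h p => (w ⟨s(a, b), h⟩ : ℝ) + walkWeight w p

/-- The weighted distance `d_w(u, v)`: the minimum of `w(P)` over all paths `P` from `u` to `v`.
It is meaningful for `u`, `v` in the same connected component, see `exists_path_weightedDist`. -/
noncomputable def weightedDist {V : Type*} {G : SimpleGraph V} (w : G.edgeSet → ℝ≥0)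
    (u v : V) : ℝ :=
  ⨅ p : G.Path u v, walkWeight w p.1

/-- On a finite graph the infimum in `weightedDist` is an attained minimum. -/
theorem exists_path_weightedDist {V : Type*} [Fintype V] [DecidableEq V] {G : SimpleGraph V}
    (w : G.edgeSet → ℝ≥0) {u v : V} (h : G.Reachable u v) :
    (∃ p : G.Path u v, walkWeight w p.1 = weightedDist w u v) ∧
      ∀ p : G.Path u v, weightedDist w u v ≤ walkWeight w p.1 := by
  classical
  obtain ⟨q⟩ := h
  have : Nonempty (G.Path u v) := ⟨q.toPath⟩
  have : Finite (G.Path u v) := inferInstance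
  exact ⟨exists_eq_ciInf_of_finite, fun p => ciInf_le (Set.finite_range _).bddBelow p⟩

/-- Two weight functions on the same edge set are neighboring if `‖w - w'‖₁ ≤ 1`. -/
def Neighboring {E : Type*} [Fintype E] (w w' : E → ℝ≥0) : Prop :=
  ∑ e, |(w e : ℝ) - (w' e : ℝ)| ≤ 1

/-- A randomized algorithm on weight functions, given by its output distributions `A w`, is
`(ε, δ)`-differentially private if `Pr[A w ∈ S] ≤ e^ε Pr[A w' ∈ S] + δ` for all neighboring
(nonnegative, possibly unbounded) weight functions and all events `S`. -/
def IsDifferentiallyPrivate {E Ω : Type*} [Fintype E] [MeasurableSpace Ω] (ε δ : ℝ)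
    (A : ProbabilityTheory.Kernel (E → ℝ≥0) Ω) : Prop :=
  ∀ w w' : E → ℝ≥0, Neighboring w w' → ∀ S : Set Ω, MeasurableSet S →
    A w S ≤ ENNReal.ofReal (Real.exp ε) * A w' S + ENNReal.ofReal δ

/-- For every weight function `w : E → [0, Λ]`, with probability at least `1 - γ` over the output
`a` of the algorithm, simultaneously for all pairs `u, v` that are joined by a path, the released
value `a u v` differs from `d_w(u, v)` by at most `err`. -/
def ReleasesAllPairsDistances {V : Type*} (G : SimpleGraph V) (Λ γ err : ℝ)
    (A : ProbabilityTheory.Kernel (G.edgeSet → ℝ≥0) (V → V → ℝ)) : Prop :=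
  ∀ w : G.edgeSet → ℝ≥0, (∀ e, (w e : ℝ) ≤ Λ) →
    ENNReal.ofReal (1 - γ) ≤
      A w {a | ∀ u v : V, G.Reachable u v → |a u v - weightedDist w u v| ≤ err}

/-! Only distances between a few centers are measured. Among the vertices whose component reaches
beyond `k` hops from them, take a maximal family pairwise more than `2k` hops apart. Their `k`-balls
are disjoint and large, so there are at most `V / k` of them (`SimpleGraph.exists_sparse_centers`).
Any vertex is within `2k` hops of a center, or its whole component is within `k` hops of it.
Rerouting through centers costs at most `4kΛ`; in the exceptional case the answer `0` is off by at
most `kΛ`.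

Each distance changes by at most `‖w - w'‖₁`, so noise need only hide a shift of `(V / k)²`
coordinates by at most one each. Laplace noise of scale `(V / k)² / ε` suffices
(`isPrivateNoise_laplace`); balancing against `kΛ` gives `(VΛ)^(2/3) ε^(-1/3)`. Gaussian noise of
deviation about `(V / k) √log(1/δ) / ε` suffices (`isPrivateNoise_gaussian`); balancing `V / (kε)`
against `kΛ` gives `√(VΛ/ε)`. A union bound over center pairs costs the logarithm, which is at least
`log c` and so absorbs additive constants. -/

open MeasureTheory ProbabilityTheory

/-! ### Weighted distances: triangle inequality and sensitivity -/

section Distance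

variable {V : Type*} {G : SimpleGraph V}

open Classical in
/-- Extension of an edge weight by zero to all unordered pairs. -/
noncomputable def extendWeight (w : G.edgeSet → ℝ≥0) (e : Sym2 V) : ℝ :=
  if h : e ∈ G.edgeSet then w ⟨e, h⟩ else 0

theorem extendWeight_nonneg (w : G.edgeSet → ℝ≥0) (e : Sym2 V) : 0 ≤ extendWeight w e := by
  unfold extendWeight
  split_ifs <;> simp

theorem walkWeight_eq_sum_edges (w : G.edgeSet → ℝ≥0) {u v : V} (p : G.Walk u v) :
    walkWeight w p = (p.edges.map (extendWeight w)).sum := by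
  induction p with
  | nil => simp [walkWeight]
  | cons h p ih => simp [walkWeight, ih, extendWeight, h]

theorem walkWeight_nonneg (w : G.edgeSet → ℝ≥0) {u v : V} (p : G.Walk u v) :
    0 ≤ walkWeight w p := by
  rw [walkWeight_eq_sum_edges]
  exact List.sum_nonneg (by simpa using fun a _ => extendWeight_nonneg w a)

theorem walkWeight_append (w : G.edgeSet → ℝ≥0) {u v x : V} (p : G.Walk u v) (q : G.Walk v x) :
    walkWeight w (p.append q) = walkWeight w p + walkWeight w q := by
  simp [walkWeight_eq_sum_edges]

theorem walkWeight_bypass_le [DecidableEq V] (w : G.edgeSet → ℝ≥0) {u v : V} (p : G.Walk u v) :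
    walkWeight w p.bypass ≤ walkWeight w p := by
  rw [walkWeight_eq_sum_edges, walkWeight_eq_sum_edges]
  refine List.Sublist.sum_le_sum (p.edges_bypass_sublist_edges.map _) ?_
  simpa using fun a _ => extendWeight_nonneg w a

theorem walkWeight_le_mul_length {w : G.edgeSet → ℝ≥0} {Λ : ℝ} (hw : ∀ e, (w e : ℝ) ≤ Λ)
    {u v : V} (p : G.Walk u v) : walkWeight w p ≤ p.length * Λ := by
  induction p with
  | nil => simp [walkWeight]
  | cons h p ih =>
    have := hw ⟨s(_, _), h⟩
    simp only [walkWeight, SimpleGraph.Walk.length_cons, Nat.cast_add, Nat.cast_one]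
    linarith

/-- A path repeats no edge, so each edge contributes at most once to the difference. -/
theorem abs_walkWeight_sub_le [Fintype G.edgeSet] (w w' : G.edgeSet → ℝ≥0) {u v : V}
    {p : G.Walk u v} (hp : p.IsPath) :
    |walkWeight w p - walkWeight w' p| ≤ ∑ e, |(w e : ℝ) - (w' e : ℝ)| := by
  classical
  rw [walkWeight_eq_sum_edges, walkWeight_eq_sum_edges,
    ← List.sum_toFinset _ hp.isTrail.edges_nodup, ← List.sum_toFinset _ hp.isTrail.edges_nodup,
    ← Finset.sum_sub_distrib]
  refine (Finset.abs_sum_le_sum_abs _ _).trans ?_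
  have hsub : ∀ e ∈ p.edges.toFinset, e ∈ G.edgeSet := fun e he =>
    p.edges_subset_edgeSet (by simpa using he)
  rw [← Finset.sum_subtype_of_mem (p := (· ∈ G.edgeSet)) _ hsub]
  refine (Finset.sum_le_sum_of_subset_of_nonneg (Finset.subset_univ _)
    fun _ _ _ => abs_nonneg _).trans (le_of_eq ?_)
  refine Finset.sum_congr rfl fun e _ => ?_
  simp [extendWeight]

theorem weightedDist_nonneg (w : G.edgeSet → ℝ≥0) (u v : V) : 0 ≤ weightedDist w u v :=
  Real.iInf_nonneg fun p => walkWeight_nonneg w p.1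

theorem measurable_walkWeight {u v : V} (p : G.Walk u v) :
    Measurable fun w : G.edgeSet → ℝ≥0 => walkWeight w p := by
  induction p with
  | nil => exact measurable_const
  | cons h p ih => exact (measurable_pi_apply (⟨s(_, _), h⟩ : G.edgeSet)).coe_nnreal_real.add ih

variable [Fintype V] [DecidableEq V]

/-- Deleting cycles turns a walk into a path without raising its weight. This lets concatenated
paths bound a distance. -/
theorem weightedDist_le_walkWeight (w : G.edgeSet → ℝ≥0) {u v : V} (p : G.Walk u v) :
    weightedDist w u v ≤ walkWeight w p :=
  ((exists_path_weightedDist w ⟨p⟩).2 p.toPath).trans (walkWeight_bypass_le w p)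

theorem weightedDist_triangle (w : G.edgeSet → ℝ≥0) {u v x : V} (huv : G.Reachable u v)
    (hvx : G.Reachable v x) :
    weightedDist w u x ≤ weightedDist w u v + weightedDist w v x := by
  obtain ⟨p, hp⟩ := (exists_path_weightedDist w huv).1
  obtain ⟨q, hq⟩ := (exists_path_weightedDist w hvx).1
  rw [← hp, ← hq, ← walkWeight_append]
  exact weightedDist_le_walkWeight w _

theorem weightedDist_le_mul {w : G.edgeSet → ℝ≥0} {Λ : ℝ} (hΛ : 0 ≤ Λ)
    (hw : ∀ e, (w e : ℝ) ≤ Λ) {u v : V} (h : G.Reachable u v) {k : ℕ} (hk : G.dist u v ≤ k) :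
    weightedDist w u v ≤ k * Λ := by
  obtain ⟨p, hp⟩ := h.exists_walk_length_eq_dist
  refine (weightedDist_le_walkWeight w p).trans ((walkWeight_le_mul_length hw p).trans ?_)
  rw [hp]
  gcongr

theorem weightedDist_sub_le [Fintype G.edgeSet] (w w' : G.edgeSet → ℝ≥0) (u v : V) :
    weightedDist w u v - weightedDist w' u v ≤ ∑ e, |(w e : ℝ) - (w' e : ℝ)| := by
  by_cases h : G.Reachable u v
  · obtain ⟨p, hp⟩ := (exists_path_weightedDist w' h).1
    have h1 := (exists_path_weightedDist w h).2 p
    have h2 := (abs_le.1 (abs_walkWeight_sub_le w w' p.2)).2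
    linarith
  -- Without a path both infima are over an empty type, hence `0`.
  · have : IsEmpty (G.Path u v) := ⟨fun p => h ⟨p.1⟩⟩
    simp only [weightedDist, Real.iInf_of_isEmpty, sub_zero]
    positivity

theorem abs_weightedDist_sub_le [Fintype G.edgeSet] (w w' : G.edgeSet → ℝ≥0) (u v : V) :
    |weightedDist w u v - weightedDist w' u v| ≤ ∑ e, |(w e : ℝ) - (w' e : ℝ)| := by
  refine abs_le.2 ⟨?_, weightedDist_sub_le w w' u v⟩
  have := weightedDist_sub_le w' w u v
  simp only [abs_sub_comm (w' _ : ℝ)] at this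
  linarith

theorem measurable_weightedDist (u v : V) :
    Measurable fun w : G.edgeSet → ℝ≥0 => weightedDist w u v := by
  have : Finite (G.Path u v) := by classical infer_instance
  exact Measurable.iInf fun p => measurable_walkWeight p.1

/-- Rerouting a pair of vertices through nearby centers changes the distance only slightly. -/
theorem abs_weightedDist_sub_weightedDist_le {w : G.edgeSet → ℝ≥0} {Λ : ℝ} (hΛ : 0 ≤ Λ)
    (hw : ∀ e, (w e : ℝ) ≤ Λ) {u v a b : V} (huv : G.Reachable u v) (hua : G.Reachable u a)
    (hvb : G.Reachable v b) {k : ℕ} (ha : G.dist u a ≤ k) (hb : G.dist v b ≤ k) :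
    |weightedDist w a b - weightedDist w u v| ≤ 2 * k * Λ := by
  have hab : G.Reachable a b := hua.symm.trans (huv.trans hvb)
  have h1 := weightedDist_triangle w hua (hab.trans hvb.symm)
  have h2 := weightedDist_triangle w hab hvb.symm
  have h3 := weightedDist_triangle w hua.symm (huv.trans hvb)
  have h4 := weightedDist_triangle w huv hvb
  have h5 := weightedDist_le_mul hΛ hw hua ha
  have h6 := weightedDist_le_mul hΛ hw hvb hb
  have h7 := weightedDist_le_mul hΛ hw hua.symm (G.dist_comm ▸ ha)
  have h8 := weightedDist_le_mul hΛ hw hvb.symm (G.dist_comm ▸ hb)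
  exact abs_le.2 ⟨by linarith, by linarith⟩

end Distance

/-! ### Sparse centers -/

section Covering

variable {V : Type*} [Fintype V] (G : SimpleGraph V)

open Classical in
-- The first `r + 1` vertices of a shortest path to `v` are distinct and lie in the ball.
theorem SimpleGraph.lt_card_edist_le {u v : V} {r : ℕ} (h : G.Reachable u v)
    (hr : r < G.dist u v) : r + 1 ≤ (Finset.univ.filter fun x => G.edist u x ≤ r).card := by
  obtain ⟨p, hp, hlen⟩ := h.exists_path_of_dist
  rw [← Finset.card_range (r + 1)]
  refine Finset.card_le_card_of_injOn p.getVert (fun i hi => ?_) fun i hi j hj hij => ?_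
  · simp only [Finset.coe_range, Set.mem_Iio] at hi
    simp only [Finset.coe_filter, Finset.mem_univ, true_and, Set.mem_ofPred_eq]
    refine (SimpleGraph.edist_le (p.take i)).trans ?_
    rw [SimpleGraph.Walk.take_length]
    exact_mod_cast (min_le_left _ _).trans (Nat.le_of_lt_succ hi)
  · simp only [Finset.coe_range, Set.mem_Iio] at hi hj
    exact hp.getVert_injOn (by simp; omega) (by simp; omega) hij

/-- A sparse set of centers: every vertex is close to a center, unless its whole component lies
close to it. -/
theorem SimpleGraph.exists_sparse_centers (r : ℕ) :
    ∃ Z : Finset V, Z.card * (r + 1) ≤ Fintype.card V ∧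
      ∀ u, (∃ z ∈ Z, G.Reachable u z ∧ G.dist u z ≤ 2 * r) ∨
        ∀ v, G.Reachable u v → G.dist u v ≤ r := by
  classical
  -- The first condition makes `r`-balls large, the second makes them disjoint. With `edist`,
  -- vertices in different components count as infinitely far apart, whereas `dist` would give `0`.
  let Q : Finset V → Prop := fun Z =>
    (∀ z ∈ Z, ∃ v, G.Reachable z v ∧ r < G.dist z v) ∧
      ∀ z ∈ Z, ∀ z' ∈ Z, z ≠ z' → ((2 * r : ℕ) : ℕ∞) < G.edist z z'
  obtain ⟨Z, hZ⟩ := (Set.toFinite {Z | Q Z}).exists_maximal ⟨∅, by simp [Q]⟩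
  have hQ : Q Z := hZ.prop
  refine ⟨Z, ?_, fun u => ?_⟩
  · have hdisj : (Z : Set V).PairwiseDisjoint
        fun z => Finset.univ.filter fun x => G.edist z x ≤ r := by
      intro z hz z' hz' hne
      refine Finset.disjoint_left.2 fun x hx hx' => ?_
      simp only [Finset.mem_filter, Finset.mem_univ, true_and] at hx hx'
      refine (hQ.2 z hz z' hz' hne).not_ge ((G.edist_triangle (v := x)).trans ?_)
      rw [G.edist_comm (u := x)]
      refine (add_le_add hx hx').trans (le_of_eq ?_)
      push_cast
      ring
    calc Z.card * (r + 1) ≤ ∑ z ∈ Z, (Finset.univ.filter fun x => G.edist z x ≤ r).card := by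
          rw [← smul_eq_mul]
          refine Finset.card_nsmul_le_sum _ _ _ fun z hz => ?_
          obtain ⟨v, hv, hr⟩ := hQ.1 z hz
          exact G.lt_card_edist_le hv hr
      _ = (Z.biUnion fun z => Finset.univ.filter fun x => G.edist z x ≤ r).card :=
          (Finset.card_biUnion hdisj).symm
      _ ≤ Fintype.card V := Finset.card_le_univ _
  -- A vertex violating both alternatives could be added to `Z`, against maximality.
  · by_contra! hu
    obtain ⟨hfar, v, hv, hr⟩ := hu
    have hfar' : ∀ z ∈ Z, ((2 * r : ℕ) : ℕ∞) < G.edist u z := by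
      intro z hz
      by_cases h : G.Reachable u z
      · rw [← h.coe_dist_eq_edist]
        exact_mod_cast hfar z hz h
      · rw [SimpleGraph.edist_eq_top_of_not_reachable h]
        exact ENat.natCast_lt_top _
    have hins : Q (insert u Z) := by
      refine ⟨?_, ?_⟩
      · intro z hz
        rcases Finset.mem_insert.1 hz with rfl | hz
        · exact ⟨v, hv, hr⟩
        · exact hQ.1 z hz
      · intro z hz z' hz' hne
        rcases Finset.mem_insert.1 hz with h | hz <;> rcases Finset.mem_insert.1 hz' with h' | hz'
        · exact absurd (h.trans h'.symm) hne
        · exact h ▸ hfar' z' hz'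
        · rw [G.edist_comm]
          exact h' ▸ hfar' z hz
        · exact hQ.2 z hz z' hz' hne
    have hmem : u ∈ Z := hZ.le_of_ge hins (Finset.subset_insert u Z) (Finset.mem_insert_self u Z)
    have := hfar' u hmem
    simp at this

end Covering

/-! ### Product noise: densities of shifts and a union bound -/

section Product

variable {ι : Type*} [Fintype ι]

/-- On a box the integrand is a product of functions of single coordinates, which are independent.
-/
theorem pi_withDensity {α : ι → Type*} [∀ i, MeasurableSpace (α i)] (μ : ∀ i, Measure (α i))
    [∀ i, IsProbabilityMeasure (μ i)] {f : ∀ i, α i → ENNReal} (hf : ∀ i, Measurable (f i))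
    [∀ i, SigmaFinite ((μ i).withDensity (f i))] :
    Measure.pi (fun i => (μ i).withDensity (f i)) =
      (Measure.pi μ).withDensity fun x => ∏ i, f i (x i) := by
  refine Measure.pi_eq (μ := fun i => (μ i).withDensity (f i)) fun S hS => ?_
  rw [withDensity_apply _ (MeasurableSet.univ_pi hS),
    ← lintegral_indicator (MeasurableSet.univ_pi hS)]
  have hind : ∀ x : ∀ i, α i, (Set.univ.pi S).indicator (fun x => ∏ i, f i (x i)) x =
      ∏ i, (S i).indicator (f i) (x i) := by
    intro x
    by_cases hx : x ∈ Set.univ.pi S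
    · rw [Set.indicator_of_mem hx]
      exact Finset.prod_congr rfl fun i _ => (Set.indicator_of_mem (hx i trivial) _).symm
    · rw [Set.indicator_of_notMem hx]
      obtain ⟨i, hi⟩ : ∃ i, x i ∉ S i := by simpa using hx
      exact (Finset.prod_eq_zero (Finset.mem_univ i) (Set.indicator_of_notMem hi _)).symm
  simp_rw [hind]
  have hm : ∀ i, Measurable ((S i).indicator (f i)) := fun i => (hf i).indicator (hS i)
  rw [lintegral_prod_eq_prod_lintegral_of_indepFun Finset.univ
    (fun i (x : ∀ i, α i) => (S i).indicator (f i) (x i))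
    (iIndepFun_pi fun i => (hm i).aemeasurable) fun i => (hm i).comp (measurable_pi_apply i)]
  refine Finset.prod_congr rfl fun i _ => ?_
  rw [(measurePreserving_eval μ i).lintegral_comp (hm i), lintegral_indicator (hS i),
    withDensity_apply _ (hS i)]

theorem map_add_withDensity {p f : ℝ → ENNReal} (hp : Measurable p) (hf : Measurable f) (s : ℝ)
    (h : ∀ x, p (x - s) = p x * f x) :
    (volume.withDensity p).map (· + s) = (volume.withDensity p).withDensity f := by
  ext S hS
  have hS' : MeasurableSet ((· + s) ⁻¹' S) := hS.preimage (measurable_add_const s)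
  rw [Measure.map_apply (measurable_add_const s) hS, withDensity_apply _ hS',
    ← withDensity_mul _ hp hf, withDensity_apply _ hS, ← lintegral_indicator hS',
    ← lintegral_indicator hS, ← lintegral_add_right_eq_self (S.indicator _) s]
  refine lintegral_congr fun x => ?_
  by_cases hx : x + s ∈ S
  · rw [Set.indicator_of_mem (show x ∈ (· + s) ⁻¹' S from hx), Set.indicator_of_mem hx, Pi.mul_apply, ← h,
      add_sub_cancel_right]
  · rw [Set.indicator_of_notMem (show x ∉ (· + s) ⁻¹' S from hx), Set.indicator_of_notMem hx]

/-- The likelihood ratio of shifted to unshifted noise, which decides privacy, is a product over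
coordinates. -/
theorem pi_map_add_withDensity {ν : Measure ℝ} [IsProbabilityMeasure ν] {f : ℝ → ℝ → ENNReal}
    (hf : ∀ s, Measurable (f s)) (h : ∀ s, ν.map (· + s) = ν.withDensity (f s)) (s : ι → ℝ) :
    (Measure.pi fun _ : ι => ν).map (· + s) =
      (Measure.pi fun _ : ι => ν).withDensity fun x => ∏ i, f (s i) (x i) := by
  have hprob : ∀ i, IsProbabilityMeasure (ν.map (· + s i)) := fun i =>
    Measure.isProbabilityMeasure_map (measurable_add_const _).aemeasurable
  have hfin : ∀ i, IsProbabilityMeasure (ν.withDensity (f (s i))) := fun i => by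
    rw [← h]; infer_instance
  rw [← pi_withDensity (fun _ : ι => ν) fun i => hf (s i)]
  simp_rw [← h]
  exact Measure.pi_map_pi (μ := fun _ : ι => ν) (f := fun i x => x + s i)
    fun i => (measurable_add_const _).aemeasurable

/-- Union bound over the coordinates of a product measure. -/
theorem pi_forall_abs_le {ν : Measure ℝ} [IsProbabilityMeasure ν] {t γ q : ℝ} (hq : 0 ≤ q)
    (ht : ν {x | t < |x|} ≤ ENNReal.ofReal q) (hγ : Fintype.card ι * q ≤ γ) :
    ENNReal.ofReal (1 - γ) ≤ (Measure.pi fun _ : ι => ν) {x | ∀ i, |x i| ≤ t} := by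
  have hm : MeasurableSet {x : ι → ℝ | ∀ i, |x i| ≤ t} := by
    simp only [Set.ofPred_forall]
    exact MeasurableSet.iInter fun i =>
      measurableSet_le (measurable_pi_apply i).abs measurable_const
  have hc : (Measure.pi fun _ : ι => ν) {x | ∀ i, |x i| ≤ t}ᶜ ≤ ENNReal.ofReal γ := by
    have : {x : ι → ℝ | ∀ i, |x i| ≤ t}ᶜ = ⋃ i, (Function.eval i) ⁻¹' {x | t < |x|} := by
      ext x; simp
    rw [this]
    refine (measure_iUnion_fintype_le _ _).trans ?_
    have hS : MeasurableSet {x : ℝ | t < |x|} :=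
      measurableSet_lt measurable_const measurable_id.abs
    calc ∑ i, (Measure.pi fun _ : ι => ν) ((Function.eval i) ⁻¹' {x | t < |x|})
        ≤ ∑ _i : ι, ENNReal.ofReal q := Finset.sum_le_sum fun i _ => by
          rw [(measurePreserving_eval (fun _ : ι => ν) i).measure_preimage hS.nullMeasurableSet]
          exact ht
      _ = ENNReal.ofReal (Fintype.card ι * q) := by
          rw [Finset.sum_const, nsmul_eq_mul, Finset.card_univ,
            ENNReal.ofReal_mul (by positivity), ENNReal.ofReal_natCast]
      _ ≤ ENNReal.ofReal γ := ENNReal.ofReal_le_ofReal hγ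
  have h1 := prob_compl_eq_one_sub (μ := Measure.pi fun _ : ι => ν) hm.compl
  rw [compl_compl] at h1
  rw [h1, ENNReal.ofReal_sub _ (le_trans (by positivity) hγ), ENNReal.ofReal_one]
  exact tsub_le_tsub_left hc _

end Product

/-- Adding noise with law `N` to a vector of queries of `ℓ∞`-sensitivity one is
`(ε, δ)`-differentially private. -/
def IsPrivateNoise {ι : Type*} (ε δ : ℝ) (N : Measure (ι → ℝ)) : Prop :=
  ∀ s : ι → ℝ, (∀ i, |s i| ≤ 1) → ∀ S, MeasurableSet S →
    N ((· + s) ⁻¹' S) ≤ ENNReal.ofReal (Real.exp ε) * N S + ENNReal.ofReal δ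

/-! ### Laplace noise -/

section Laplace

/-- The density of the centered Laplace distribution of scale `b`. -/
noncomputable def laplaceDensity (b x : ℝ) : ENNReal :=
  ENNReal.ofReal (Real.exp (-|x| / b) / (2 * b))

/-- The centered Laplace distribution of scale `b`. -/
noncomputable def laplaceMeasure (b : ℝ) : Measure ℝ :=
  volume.withDensity (laplaceDensity b)

theorem measurable_laplaceDensity (b : ℝ) : Measurable (laplaceDensity b) := by
  unfold laplaceDensity
  fun_prop

theorem isProbabilityMeasure_laplaceMeasure {b : ℝ} (hb : 0 < b) :
    IsProbabilityMeasure (laplaceMeasure b) := by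
  have hint : ∫ x : ℝ, Real.exp (-|x| / b) / (2 * b) = 1 := by
    have h1 := integral_comp_abs (f := fun x => Real.exp (-x / b) / (2 * b))
    have h2 := integral_exp_mul_Ioi (a := -b⁻¹) (by simpa using hb) 0
    have h3 : ∀ x : ℝ, -x / b = -b⁻¹ * x := fun x => by ring
    rw [h1, integral_div]
    simp_rw [h3]
    rw [h2]
    field_simp
    simp
  constructor
  rw [laplaceMeasure, withDensity_apply _ MeasurableSet.univ, Measure.restrict_univ]
  unfold laplaceDensity
  rw [← ofReal_integral_eq_lintegral_ofReal (integrable_of_integral_eq_one hint)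
    (ae_of_all _ fun x => by positivity), hint, ENNReal.ofReal_one]

theorem laplaceMeasure_map_add {b : ℝ} (hb : 0 < b) (s : ℝ) :
    (laplaceMeasure b).map (· + s) = (laplaceMeasure b).withDensity
      fun x => ENNReal.ofReal (Real.exp ((|x| - |x - s|) / b)) := by
  refine map_add_withDensity (measurable_laplaceDensity b) (by fun_prop) s fun x => ?_
  rw [laplaceDensity, laplaceDensity, ← ENNReal.ofReal_mul (by positivity), div_mul_eq_mul_div,
    ← Real.exp_add]
  congr 3
  ring

/-- For `|x| > t` the density is at most `2 exp (-t / (2b))` times that of scale `2b`, whose total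
mass is one. The lost factor in the exponent affects only constants. -/
theorem laplaceMeasure_tail {b : ℝ} (hb : 0 < b) (t : ℝ) :
    laplaceMeasure b {x | t < |x|} ≤ ENNReal.ofReal (2 * Real.exp (-t / (2 * b))) := by
  have hS : MeasurableSet {x : ℝ | t < |x|} := measurableSet_lt measurable_const measurable_id.abs
  have := isProbabilityMeasure_laplaceMeasure (b := 2 * b) (by positivity)
  rw [laplaceMeasure, withDensity_apply _ hS]
  calc ∫⁻ x in {x | t < |x|}, laplaceDensity b x
      ≤ ∫⁻ x in {x | t < |x|},
          ENNReal.ofReal (2 * Real.exp (-t / (2 * b))) * laplaceDensity (2 * b) x := by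
        refine setLIntegral_mono ((measurable_laplaceDensity _).const_mul _) fun x hx => ?_
        rw [laplaceDensity, laplaceDensity, ← ENNReal.ofReal_mul (by positivity)]
        refine ENNReal.ofReal_le_ofReal ?_
        have h1 : 2 * Real.exp (-t / (2 * b)) * (Real.exp (-|x| / (2 * b)) / (2 * (2 * b))) =
            Real.exp (-t / (2 * b) + -|x| / (2 * b)) / (2 * b) := by
          rw [Real.exp_add]
          field_simp
        rw [h1]
        gcongr
        have hx' : t < |x| := hx
        rw [← add_div, div_le_div_iff₀ hb (by positivity)]
        nlinarith
    _ = ENNReal.ofReal (2 * Real.exp (-t / (2 * b))) * laplaceMeasure (2 * b) {x | t < |x|} := by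
        rw [lintegral_const_mul _ (measurable_laplaceDensity _), laplaceMeasure,
          withDensity_apply _ hS]
    _ ≤ ENNReal.ofReal (2 * Real.exp (-t / (2 * b))) * 1 := by gcongr; exact prob_le_one
    _ = _ := mul_one _

/-- By the triangle inequality each coordinate contributes at most `exp (1 / b)` to the likelihood
ratio. -/
theorem isPrivateNoise_laplace {ι : Type*} [Fintype ι] {b ε : ℝ} (hb : 0 < b)
    (hε : Fintype.card ι ≤ ε * b) :
    IsPrivateNoise ε 0 (Measure.pi fun _ : ι => laplaceMeasure b) := by
  intro s hs S hS
  have := isProbabilityMeasure_laplaceMeasure hb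
  rw [← Measure.map_apply (measurable_add_const s) hS,
    pi_map_add_withDensity (fun s => by fun_prop) (laplaceMeasure_map_add hb),
    withDensity_apply _ hS, ENNReal.ofReal_zero, add_zero, ← setLIntegral_const]
  refine setLIntegral_mono measurable_const fun x _ => ?_
  rw [← ENNReal.ofReal_prod_of_nonneg fun _ _ => (Real.exp_pos _).le, ← Real.exp_sum]
  refine ENNReal.ofReal_le_ofReal (Real.exp_le_exp.2 ?_)
  calc ∑ i, (|x i| - |x i - s i|) / b ≤ ∑ _i : ι, 1 / b := by
        refine Finset.sum_le_sum fun i _ => ?_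
        gcongr
        have := abs_sub_abs_le_abs_sub (x i) (x i - s i)
        rw [sub_sub_cancel] at this
        exact this.trans (hs i)
    _ ≤ ε := by
        rw [Finset.sum_const, nsmul_eq_mul, Finset.card_univ, mul_one_div, div_le_iff₀ hb]
        exact hε

end Laplace

/-! ### Gaussian noise -/

section Gaussian

theorem ProbabilityTheory.HasSubgaussianMGF.mono {Ω : Type*} [MeasurableSpace Ω] {μ : Measure Ω}
    {X : Ω → ℝ} {c c' : ℝ≥0} (h : HasSubgaussianMGF X c μ) (hc : c ≤ c') :
    HasSubgaussianMGF X c' μ :=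
  ⟨h.integrable_exp_mul, fun t => (h.mgf_le t).trans (by gcongr)⟩

theorem hasSubgaussianMGF_gaussianReal (v : ℝ≥0) :
    HasSubgaussianMGF (fun x => x) v (gaussianReal 0 v) :=
  ⟨integrable_exp_mul_gaussianReal, fun t => by rw [mgf_fun_id_gaussianReal]; simp⟩

theorem gaussianReal_tail (v : ℝ≥0) {t : ℝ} (ht : 0 ≤ t) :
    gaussianReal 0 v {x | t < |x|} ≤ ENNReal.ofReal (2 * Real.exp (-t ^ 2 / (2 * v))) := by
  have hX := hasSubgaussianMGF_gaussianReal v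
  have h1 := hX.measure_ge_le ht
  have h2 := hX.neg.measure_ge_le ht
  have hsub : {x : ℝ | t < |x|} ⊆ {x | t ≤ x} ∪ {x | t ≤ (-fun x : ℝ => x) x} := fun x hx => by
    rcases lt_abs.1 (show t < |x| from hx) with h | h
    · exact Or.inl h.le
    · exact Or.inr h.le
  rw [← ofReal_measureReal]
  refine ENNReal.ofReal_le_ofReal ?_
  linarith [(measureReal_mono hsub).trans (measureReal_union_le (μ := gaussianReal 0 v) _ _)]

theorem gaussianReal_map_add_eq_withDensity {v : ℝ≥0} (hv : v ≠ 0) (s : ℝ) :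
    (gaussianReal 0 v).map (· + s) = (gaussianReal 0 v).withDensity
      fun x => ENNReal.ofReal (Real.exp ((s * x - s ^ 2 / 2) / v)) := by
  rw [gaussianReal_of_var_ne_zero 0 hv]
  refine map_add_withDensity (measurable_gaussianPDF 0 v) (by fun_prop) s fun x => ?_
  rw [gaussianPDF, gaussianPDF, ← ENNReal.ofReal_mul (gaussianPDFReal_nonneg _ _ _),
    gaussianPDFReal, gaussianPDFReal, mul_assoc _ (Real.exp _), ← Real.exp_add]
  have : (v : ℝ) ≠ 0 := by exact_mod_cast hv
  congr 3
  field_simp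
  ring

/-- Gaussian noise is private if the privacy loss has a small tail. -/
theorem isPrivateNoise_gaussian {ι : Type*} [Fintype ι] {v m : ℝ≥0} {ε δ : ℝ} (hv : v ≠ 0)
    (hm : Fintype.card ι ≤ m) (hε : m / 2 ≤ ε * v)
    (hδ : Real.exp (-(ε * v - m / 2) ^ 2 / (2 * (m * v))) ≤ δ) :
    IsPrivateNoise ε δ (Measure.pi fun _ : ι => gaussianReal 0 v) := by
  intro s hs S hS
  set N := Measure.pi fun _ : ι => gaussianReal 0 v
  have hv' : (0 : ℝ) < v := by exact_mod_cast pos_iff_ne_zero.2 hv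
  have hs2 : ∀ i, s i ^ 2 ≤ 1 := fun i => (sq_le_one_iff_abs_le_one _).2 (hs i)
  set F : (ι → ℝ) → ENNReal :=
    fun x => ∏ i, ENNReal.ofReal (Real.exp ((s i * x i - s i ^ 2 / 2) / v)) with hFdef
  have hFm : Measurable F := by fun_prop
  have hF : ∀ x, F x = ENNReal.ofReal (Real.exp (∑ i, (s i * x i - s i ^ 2 / 2) / v)) := fun x => by
    rw [hFdef, Real.exp_sum, ENNReal.ofReal_prod_of_nonneg fun _ _ => (Real.exp_pos _).le]
  have hmap : N.map (· + s) = N.withDensity F :=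
    pi_map_add_withDensity (fun s => by fun_prop) (gaussianReal_map_add_eq_withDensity hv) s
  -- Where the likelihood ratio is at most `exp ε` the multiplicative bound holds; the rest is
  -- charged to `δ`.
  set A : Set (ι → ℝ) := {x | F x ≤ ENNReal.ofReal (Real.exp ε)}
  have hA : MeasurableSet A := measurableSet_le hFm measurable_const
  have hgood : N.map (· + s) (S ∩ A) ≤ ENNReal.ofReal (Real.exp ε) * N S := by
    rw [hmap, withDensity_apply _ (hS.inter hA)]
    calc ∫⁻ x in S ∩ A, F x ∂N ≤ ∫⁻ _ in S ∩ A, ENNReal.ofReal (Real.exp ε) ∂N :=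
          setLIntegral_mono measurable_const fun x hx => hx.2
      _ = ENNReal.ofReal (Real.exp ε) * N (S ∩ A) := setLIntegral_const _ _
      _ ≤ _ := by gcongr; exact Set.inter_subset_left
  have hsub : HasSubgaussianMGF (fun x : ι → ℝ => ∑ i, s i * x i) (m * v) N := by
    have hind : iIndepFun (fun i (x : ι → ℝ) => s i * x i) N :=
      iIndepFun_pi (X := fun i (y : ℝ) => s i * y) fun i => by fun_prop
    have hX : ∀ i ∈ Finset.univ, HasSubgaussianMGF (fun x : ι → ℝ => s i * x i) v N := fun i _ => by
      have h0 : HasSubgaussianMGF (fun x : ι → ℝ => x i) v N :=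
        HasSubgaussianMGF.of_map (Y := fun x : ι → ℝ => x i) (X := fun y : ℝ => y)
          (measurable_pi_apply i).aemeasurable (by
            rw [(measurePreserving_eval (fun _ : ι => gaussianReal 0 v) i).map_eq]
            exact hasSubgaussianMGF_gaussianReal v)
      refine (h0.const_mul (s i)).mono ?_
      rw [← NNReal.coe_le_coe]
      exact mul_le_of_le_one_left v.2 (hs2 i)
    refine (HasSubgaussianMGF.sum_of_iIndepFun hind hX).mono ?_
    rw [Finset.sum_const, nsmul_eq_mul, Finset.card_univ]
    gcongr
  have hbad : N.map (· + s) Aᶜ ≤ ENNReal.ofReal δ := by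
    rw [Measure.map_apply (measurable_add_const s) hA.compl, ← ofReal_measureReal]
    refine ENNReal.ofReal_le_ofReal (le_trans ?_ hδ)
    have h1 := hsub.measure_ge_le (sub_nonneg.2 hε)
    push_cast at h1
    refine (measureReal_mono fun x hx => ?_).trans h1
    -- At the shifted point the log-ratio is `∑ (s i * x i + s i ^ 2 / 2) / v`, so exceeding `ε`
    -- forces the sub-Gaussian sum above `ε * v - m / 2`.
    have hx' : ε < ∑ i, (s i * (x i + s i) - s i ^ 2 / 2) / v := by
      have : ¬ F (x + s) ≤ ENNReal.ofReal (Real.exp ε) := hx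
      rw [hF, not_le, ENNReal.ofReal_lt_ofReal_iff (Real.exp_pos _), Real.exp_lt_exp] at this
      exact this
    rw [← Finset.sum_div, lt_div_iff₀ hv'] at hx'
    have h2 : ∑ i, (s i * (x i + s i) - s i ^ 2 / 2) ≤ ∑ i, (s i * x i + 1 / 2) :=
      Finset.sum_le_sum fun i _ => by nlinarith [hs2 i]
    rw [Finset.sum_add_distrib, Finset.sum_const, nsmul_eq_mul, Finset.card_univ] at h2
    have hm' : (Fintype.card ι : ℝ) ≤ m := by exact_mod_cast hm
    show ε * v - m / 2 ≤ ∑ i, s i * x i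
    linarith
  calc N ((· + s) ⁻¹' S) = N.map (· + s) S :=
        (Measure.map_apply (measurable_add_const s) hS).symm
    _ ≤ N.map (· + s) (S ∩ A) + N.map (· + s) Aᶜ :=
        (measure_mono (fun x hx => by
          by_cases h : x ∈ A
          exacts [Or.inl ⟨hx, h⟩, Or.inr h])).trans (measure_union_le _ _)
    _ ≤ _ := add_le_add hgood hbad

end Gaussian

/-- A covering at hop distance about `k`, for real `k > 0`, with at most `M ≥ V / k` centers. -/
theorem SimpleGraph.exists_covering {V : Type*} [Fintype V] (G : SimpleGraph V) {k M : ℝ} (hk : 0 < k)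
    (hM : Fintype.card V ≤ M * k) :
    ∃ (Z : Finset V) (r : ℕ), (Z.card : ℝ) ≤ M ∧ (r : ℝ) ≤ k ∧
      ∀ u, (∃ z ∈ Z, G.Reachable u z ∧ G.dist u z ≤ 2 * r) ∨
        ∀ v, G.Reachable u v → G.dist u v ≤ r := by
  -- Rounding down is harmless because `k < ⌊k⌋₊ + 1`, also when `k < 1`.
  obtain ⟨Z, hcard, hZ⟩ := G.exists_sparse_centers ⌊k⌋₊
  refine ⟨Z, ⌊k⌋₊, ?_, Nat.floor_le hk.le, hZ⟩
  have h1 : (Z.card : ℝ) * (⌊k⌋₊ + 1) ≤ Fintype.card V := by exact_mod_cast hcard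
  have h2 : (Z.card : ℝ) * k ≤ Z.card * (⌊k⌋₊ + 1) := by
    gcongr
    exact (Nat.lt_floor_add_one k).le
  exact le_of_mul_le_mul_right (h2.trans (h1.trans hM)) hk

/-! ### From private noise to a private release -/

section Mechanism

variable {V : Type*} [Fintype V] [DecidableEq V] {G : SimpleGraph V}

/-- Private noise on the pairs of centers of a covering yields a private release of all pairs of
distances. -/
theorem exists_kernel_of_isPrivateNoise [Fintype G.edgeSet] {Z : Finset V} {r : ℕ}
    (hZ : ∀ u, (∃ z ∈ Z, G.Reachable u z ∧ G.dist u z ≤ 2 * r) ∨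
      ∀ v, G.Reachable u v → G.dist u v ≤ r)
    {ε δ γ Λ t err : ℝ} (hΛ : 0 ≤ Λ) (ht : 0 ≤ t) (herr : t + 4 * (r * Λ) ≤ err)
    {N : Measure (Z × Z → ℝ)} [IsProbabilityMeasure N] (hpriv : IsPrivateNoise ε δ N)
    (hN : ENNReal.ofReal (1 - γ) ≤ N {x | ∀ i, |x i| ≤ t}) :
    ∃ A : Kernel (G.edgeSet → ℝ≥0) (V → V → ℝ),
      IsMarkovKernel A ∧ IsDifferentiallyPrivate ε δ A ∧ ReleasesAllPairsDistances G Λ γ err A := by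
  classical
  -- `none` marks a vertex whose component lies within `r` hops; pairs involving one are answered by
  -- `0`.
  have hctr : ∀ u, ∃ o : Option Z, (∀ z : Z, o = some z → G.Reachable u z ∧ G.dist u z ≤ 2 * r) ∧
      (o = none → ∀ v, G.Reachable u v → G.dist u v ≤ r) := by
    intro u
    rcases hZ u with ⟨z, hz, h⟩ | h
    · exact ⟨some ⟨z, hz⟩, fun z' hz' => by cases hz'; exact h, fun h => by cases h⟩
    · exact ⟨none, fun z' hz' => absurd hz' (by simp), fun _ => h⟩
  choose ctr hctr hctr' using hctr
  let query : (G.edgeSet → ℝ≥0) → Z × Z → ℝ := fun w i => weightedDist w i.1 i.2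
  let post : (Z × Z → ℝ) → V → V → ℝ := fun y u v =>
    match ctr u, ctr v with
    | some a, some b => y (a, b)
    | _, _ => 0
  have hquery : Measurable query := measurable_pi_lambda _ fun i => measurable_weightedDist _ _
  have hpost : Measurable post := by
    refine measurable_pi_lambda _ fun u => measurable_pi_lambda _ fun v => ?_
    rcases hu : ctr u with _ | a
    · simp only [post, hu]; exact measurable_const
    · rcases hv : ctr v with _ | b
      · simp only [post, hu, hv]; exact measurable_const
      · simp only [post, hu, hv]; exact measurable_pi_apply _
  have hsum : Measurable fun p : (G.edgeSet → ℝ≥0) × (Z × Z → ℝ) => post (p.2 + query p.1) :=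
    hpost.comp (measurable_snd.add (hquery.comp measurable_fst))
  let A : Kernel (G.edgeSet → ℝ≥0) (V → V → ℝ) :=
    (Kernel.id ×ₖ Kernel.const _ N).map fun p => post (p.2 + query p.1)
  have hA : ∀ w S, MeasurableSet S → A w S = N ((· + query w) ⁻¹' (post ⁻¹' S)) := by
    intro w S hS
    rw [Kernel.map_apply' _ hsum _ hS, Kernel.prod_apply, Kernel.id_apply, Kernel.const_apply,
      Measure.dirac_prod, Measure.map_apply measurable_prodMk_left (hS.preimage hsum)]
    rfl
  refine ⟨A, Kernel.IsMarkovKernel.map _ hsum, fun w w' hww S hS => ?_, fun w hw => ?_⟩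
  · rw [hA w S hS, hA w' S hS]
    -- Noise plus `query w` is noise plus `query w'` shifted by the difference of the queries, which
    -- is at most one in each coordinate.
    have h := hpriv (query w - query w')
      (fun i => (abs_weightedDist_sub_le w w' _ _).trans hww) ((· + query w') ⁻¹' (post ⁻¹' S))
      ((hS.preimage hpost).preimage (measurable_add_const _))
    convert h using 2
    ext x
    simp [add_assoc]
  · have hmeas : MeasurableSet
        {a : V → V → ℝ | ∀ u v, G.Reachable u v → |a u v - weightedDist w u v| ≤ err} := by
      simp only [Set.ofPred_forall]
      refine MeasurableSet.iInter fun u => MeasurableSet.iInter fun v =>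
        MeasurableSet.iInter fun _ => measurableSet_le ?_ measurable_const
      exact (((measurable_pi_apply v).comp (measurable_pi_apply u)).sub_const _).abs
    rw [hA w _ hmeas]
    refine hN.trans (measure_mono fun x hx u v huv => ?_)
    have hsmall : G.dist u v ≤ r → |0 - weightedDist w u v| ≤ err := fun h => by
      have h1 := weightedDist_le_mul hΛ hw huv h
      have h2 := weightedDist_nonneg w u v
      have h3 : 0 ≤ r * Λ := by positivity
      rw [zero_sub, abs_neg, abs_of_nonneg h2]
      linarith
    rcases hu : ctr u with _ | a
    · simpa only [post, hu] using hsmall (hctr' u hu v huv)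
    · rcases hv : ctr v with _ | b
      · simpa only [post, hu, hv] using hsmall (G.dist_comm ▸ hctr' v hv u huv.symm)
      · have h1 : |x (a, b)| ≤ t := hx (a, b)
        have h2 := abs_weightedDist_sub_weightedDist_le hΛ hw huv (hctr u a hu).1 (hctr v b hv).1
          (hctr u a hu).2 (hctr v b hv).2
        push_cast at h2
        have h3 := abs_add_le (x (a, b)) (weightedDist w a b - weightedDist w u v)
        simp only [post, hu, hv, query, Pi.add_apply]
        rw [add_sub_assoc]
        linarith

end Mechanism

/-! ### Balancing noise against covering error -/

section Release

variable {V : Type*} [Fintype V] [DecidableEq V] (G : SimpleGraph V) [Fintype G.edgeSet]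

/-- Gaussian noise on a covering; `X = V Λ / ε`. -/
theorem exists_kernel_gaussian {ε δ γ Λ X K B L l : ℝ} (hε : 0 < ε) (hε1 : ε < 1) (hδ : 0 < δ)
    (hγ : 0 < γ) (hΛ : 0 < Λ) (hX : 0 < X) (hV : Fintype.card V * Λ = X * ε)
    (hl : l = Real.log (1 / δ)) (hl0 : 0 < l) (hK : 8 ≤ K) (hKl : 1 ≤ K * l)
    (hL0 : 0 ≤ L) (hL : X * ε ^ 2 = Real.exp L * γ) (hB : 0 ≤ B) (hBL : L + 1 ≤ B ^ 2 * L ^ 2 / 2) :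
    ∃ A : Kernel (G.edgeSet → ℝ≥0) (V → V → ℝ), IsMarkovKernel A ∧
      IsDifferentiallyPrivate ε δ A ∧ ReleasesAllPairsDistances G Λ γ
        (√(X * (K * l)) * (B * L) + 4 * √X) A := by
  obtain ⟨Z, r, hcard, hr, hZ⟩ := G.exists_covering (k := √X / Λ) (M := √X * ε) (by positivity) (by
    rw [mul_div_assoc', le_div_iff₀ hΛ, hV, mul_right_comm, Real.mul_self_sqrt hX.le])
  have hcard2 : (Fintype.card (Z × Z) : ℝ) ≤ X * ε ^ 2 := by
    rw [Fintype.card_prod, Fintype.card_coe]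
    push_cast
    refine (mul_self_le_mul_self (by positivity) hcard).trans (le_of_eq ?_)
    rw [← sq, mul_pow, Real.sq_sqrt hX.le]
  have hv0 : 0 < X * (K * l) := by positivity
  let v : ℝ≥0 := ⟨X * (K * l), hv0.le⟩
  let m : ℝ≥0 := ⟨X * ε ^ 2, by positivity⟩
  have hm0 : (m : ℝ) = X * ε ^ 2 := rfl
  have hvc : (v : ℝ) = X * (K * l) := rfl
  -- Hence `ε * v - m / 2 ≥ ε * v / 2`, and the tail exponent is at least `K * l / 8 ≥ l`.
  have hmv : (m : ℝ) ≤ ε * v := by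
    rw [hm0, hvc]
    have : ε ^ 2 ≤ ε * (K * l) := by nlinarith
    nlinarith
  have hpriv : IsPrivateNoise ε δ (Measure.pi fun _ : Z × Z => gaussianReal 0 v) := by
    refine isPrivateNoise_gaussian (m := m) (ne_of_gt (show (0 : ℝ≥0) < v from hv0))
      (by exact_mod_cast hcard2) (by have := m.2; linarith) ?_
    have hδ' : δ = Real.exp (-l) := by
      rw [hl, one_div, Real.log_inv, neg_neg, Real.exp_log hδ]
    rw [hδ', neg_div]
    refine Real.exp_le_exp.2 (neg_le_neg ?_)
    have hm : (0 : ℝ) < m := by rw [hm0]; positivity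
    have hv : (0 : ℝ) < v := hv0
    rw [le_div_iff₀ (by positivity)]
    have h1 : (ε * v / 2) ^ 2 ≤ (ε * v - m / 2) ^ 2 := by
      gcongr
      linarith
    refine le_trans ?_ h1
    have h2 : (ε * v / 2) ^ 2 = (X * ε ^ 2) * v * (K * l / 4) := by rw [hvc]; ring
    rw [h2, hm0]
    have h3 : 0 < X * ε ^ 2 * v := by positivity
    nlinarith [mul_le_mul_of_nonneg_right hK hl0.le]
  refine exists_kernel_of_isPrivateNoise hZ hΛ.le (by positivity) ?_ hpriv
    (pi_forall_abs_le (t := √(X * (K * l)) * (B * L)) (by positivity)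
      (gaussianReal_tail v (by positivity)) ?_)
  · gcongr
    exact (le_div_iff₀ hΛ).1 hr
  · have h1 : (√(X * (K * l)) * (B * L)) ^ 2 / (2 * v) = B ^ 2 * L ^ 2 / 2 := by
      rw [mul_pow, Real.sq_sqrt hv0.le, hvc]
      field_simp
    rw [neg_div, h1]
    have h2 : Real.exp (-(B ^ 2 * L ^ 2 / 2)) ≤ Real.exp (-L) * Real.exp (-1) := by
      rw [← Real.exp_add]
      exact Real.exp_le_exp.2 (by linarith)
    have h3 : Real.exp (-1) ≤ 1 / 2 := by
      have := Real.exp_neg_one_lt_d9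
      linarith
    calc (Fintype.card (Z × Z) : ℝ) * (2 * Real.exp (-(B ^ 2 * L ^ 2 / 2)))
        ≤ (Real.exp L * γ) * (2 * (Real.exp (-L) * (1 / 2))) := by
          rw [← hL]
          gcongr
          exact h2.trans (by gcongr)
      _ = γ := by
          rw [Real.exp_neg]
          field_simp

/-- Laplace noise on a covering; `p ^ 3 = V Λ` and `q ^ 3 = ε`. -/
theorem exists_kernel_laplace {γ Λ p q L : ℝ} (hγ : 0 < γ) (hΛ : 0 < Λ)
    (hp : 0 < p) (hq : 0 < q) (hV : Fintype.card V * Λ = p ^ 3) (hL0 : 0 ≤ L) (hpq : 1 ≤ p * q)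
    (hL : (p * q) ^ 3 = Real.exp L * γ) :
    ∃ A : Kernel (G.edgeSet → ℝ≥0) (V → V → ℝ), IsMarkovKernel A ∧
      IsDifferentiallyPrivate (q ^ 3) 0 A ∧ ReleasesAllPairsDistances G Λ γ
        (p ^ 2 / q * (2 * L + 6)) A := by
  have hb : 0 < p ^ 2 / q := by positivity
  obtain ⟨Z, r, hcard, hr, hZ⟩ := G.exists_covering (k := p ^ 2 / q / Λ) (M := p * q)
    (by positivity) (by
      rw [mul_div_assoc', le_div_iff₀ hΛ, hV]
      refine le_of_eq ?_
      field_simp)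
  have hcard2 : (Fintype.card (Z × Z) : ℝ) ≤ (p * q) ^ 2 := by
    rw [Fintype.card_prod, Fintype.card_coe]
    push_cast
    exact (mul_self_le_mul_self (by positivity) hcard).trans (le_of_eq (sq _).symm)
  have := isProbabilityMeasure_laplaceMeasure hb
  refine exists_kernel_of_isPrivateNoise hZ hΛ.le (t := p ^ 2 / q * (2 * L + 2)) (by positivity) ?_
    (isPrivateNoise_laplace hb (hcard2.trans (le_of_eq (by field_simp))))
    (pi_forall_abs_le (by positivity) (laplaceMeasure_tail hb _) ?_)
  · have := (le_div_iff₀ hΛ).1 hr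
    linarith
  · have h1 : -(p ^ 2 / q * (2 * L + 2)) / (2 * (p ^ 2 / q)) = -L + -1 := by
      field_simp
      ring
    have h3 : Real.exp (-1) ≤ 1 / 2 := by
      have := Real.exp_neg_one_lt_d9
      linarith
    rw [h1, Real.exp_add]
    calc (Fintype.card (Z × Z) : ℝ) * (2 * (Real.exp (-L) * Real.exp (-1)))
        ≤ (Real.exp L * γ) * (2 * (Real.exp (-L) * (1 / 2))) := by
          rw [← hL]
          gcongr
          -- Since `p * q ≥ 1`, the pair count `(p * q) ^ 2` is at most `(p * q) ^ 3 = exp L * γ`.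
          exact hcard2.trans (pow_le_pow_right₀ hpq (by norm_num))
      _ = γ := by
          rw [Real.exp_neg]
          field_simp

end Release

/-! ### Constants and conclusion -/

theorem ReleasesAllPairsDistances.mono {V : Type*} {G : SimpleGraph V} {Λ γ err err' : ℝ}
    {A : Kernel (G.edgeSet → ℝ≥0) (V → V → ℝ)} (h : ReleasesAllPairsDistances G Λ γ err A)
    (herr : err ≤ err') : ReleasesAllPairsDistances G Λ γ err' A :=
  fun w hw => (h w hw).trans (measure_mono fun _ ha u v huv => (ha u v huv).trans herr)

theorem mainTheorem5 (c : ℝ) (hc : 1 < c) :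
    ∃ C : ℝ, 0 < C ∧
      (∀ (V : Type*) [Fintype V] [DecidableEq V] (G : SimpleGraph V) [DecidableRel G.Adj]
          (ε δ γ Λ : ℝ), 0 < ε → ε < 1 → 0 < δ → δ ≤ 1 / c → 0 < γ → γ < 1 →
          1 / (Fintype.card V : ℝ) < Λ * ε → Λ * ε < Fintype.card V →
          c ≤ Fintype.card V * Λ * ε / γ →
          ∃ A : ProbabilityTheory.Kernel (G.edgeSet → ℝ≥0) (V → V → ℝ),
            ProbabilityTheory.IsMarkovKernel A ∧
            IsDifferentiallyPrivate ε δ A ∧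
            ReleasesAllPairsDistances G Λ γ
              (C * (Real.sqrt (Fintype.card V * Λ * ε⁻¹ * Real.log (1 / δ)) *
                Real.log (Fintype.card V * Λ * ε / γ))) A) ∧
      (∀ (V : Type*) [Fintype V] [DecidableEq V] (G : SimpleGraph V) [DecidableRel G.Adj]
          (ε γ Λ : ℝ), 0 < ε → 0 < γ → γ < 1 →
          1 / (Fintype.card V : ℝ) < Λ * ε → Λ * ε < (Fintype.card V : ℝ) ^ 2 →
          c ≤ Fintype.card V * Λ * ε / γ →
          ∃ B : ProbabilityTheory.Kernel (G.edgeSet → ℝ≥0) (V → V → ℝ),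
            ProbabilityTheory.IsMarkovKernel B ∧
            IsDifferentiallyPrivate ε 0 B ∧
            ReleasesAllPairsDistances G Λ γ
              (C * ((Fintype.card V * Λ) ^ (2 / 3 : ℝ) * ε ^ (-(1 / 3) : ℝ) *
                Real.log (Fintype.card V * Λ * ε / γ))) B) := by
  set l₀ := Real.log c with hl₀
  have hl₀pos : 0 < l₀ := Real.log_pos hc
  -- The `8` serves the Gaussian tail exponent; `1 / l₀` ensures `K * log (1 / δ) ≥ 1` when `δ ≤ 1 /
  -- c`.
  set K := max 8 (1 / l₀) with hKdef
  -- Chosen so that `B ^ 2 * L ^ 2 / 2 = L * (L / l₀) + (L / l₀) ^ 2 ≥ L + 1` for `L ≥ l₀`.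
  set B := √(2 / l₀ + 2 / l₀ ^ 2) with hBdef
  have hK8 : 8 ≤ K := le_max_left _ _
  have hKl₀ : 1 ≤ K * l₀ := (div_le_iff₀ hl₀pos).1 (le_max_right _ _)
  have hC₁ : 0 < √K * B + 4 / (√l₀ * l₀) := by positivity
  have hC₂ : 0 < 2 + 6 / l₀ := by positivity
  refine ⟨(√K * B + 4 / (√l₀ * l₀)) + (2 + 6 / l₀), by positivity, ?_, ?_⟩
  · intro V _ _ G _ ε δ γ Λ hε hε1 hδ hδc hγ _ hlow hup hcV
    have hΛε : 0 < Λ * ε := lt_of_le_of_lt (by positivity) hlow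
    have hV : (0 : ℝ) < Fintype.card V := hΛε.trans hup
    have hΛ : 0 < Λ := pos_of_mul_pos_left hΛε hε.le
    set L := Real.log (Fintype.card V * Λ * ε / γ) with hLdef
    have hL : l₀ ≤ L := Real.log_le_log (by linarith) hcV
    set l := Real.log (1 / δ) with hldef
    have hl : l₀ ≤ l := Real.log_le_log (by linarith) ((le_div_comm₀ hδ (by linarith)).1 hδc)
    have hlpos := hl₀pos.trans_le hl
    have hLpos := hl₀pos.trans_le hL
    set X := Fintype.card V * Λ * ε⁻¹ with hXdef
    have hX : 0 < X := by positivity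
    have hBL : L + 1 ≤ B ^ 2 * L ^ 2 / 2 := by
      rw [hBdef, Real.sq_sqrt (by positivity)]
      have h1 : 1 ≤ L / l₀ := (one_le_div hl₀pos).2 hL
      have h2 : (2 / l₀ + 2 / l₀ ^ 2) * L ^ 2 / 2 = L * (L / l₀) + (L / l₀) ^ 2 := by
        field_simp
      rw [h2]
      nlinarith
    obtain ⟨A, hA, hpriv, hrel⟩ := exists_kernel_gaussian G (K := K) (B := B) (L := L) hε hε1 hδ hγ
      hΛ hX (by rw [hXdef]; field_simp) hldef hlpos hK8
      (hKl₀.trans (by gcongr)) hLpos.le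
      (by rw [hLdef, Real.exp_log (by positivity), hXdef]; field_simp) (Real.sqrt_nonneg _) hBL
    refine ⟨A, hA, hpriv, hrel.mono ?_⟩
    have h1 : √(X * (K * l)) = √K * √(X * l) := by
      rw [← Real.sqrt_mul (by positivity)]
      congr 1
      ring
    -- The covering error lacks both logarithms; each is at least `l₀`.
    have h2 : √X ≤ √(X * l) * L / (√l₀ * l₀) := by
      rw [le_div_iff₀ (by positivity), Real.sqrt_mul hX.le, mul_assoc]
      gcongr
    have h3 : 0 ≤ (2 + 6 / l₀) * (√(X * l) * L) := by positivity
    calc √(X * (K * l)) * (B * L) + 4 * √X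
        ≤ √K * √(X * l) * (B * L) + 4 * (√(X * l) * L / (√l₀ * l₀)) := by rw [h1]; gcongr
      _ = (√K * B + 4 / (√l₀ * l₀)) * (√(X * l) * L) := by ring
      _ ≤ _ := by linarith
  · intro V _ _ G _ ε γ Λ hε hγ _ hlow hup hcV
    have hΛε : 0 < Λ * ε := lt_of_le_of_lt (by positivity) hlow
    have hV : (0 : ℝ) < Fintype.card V := by
      refine lt_of_le_of_ne (by positivity) fun h => ?_
      rw [← h] at hup
      norm_num at hup
      linarith
    have hΛ : 0 < Λ := pos_of_mul_pos_left hΛε hε.le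
    set L := Real.log (Fintype.card V * Λ * ε / γ) with hLdef
    have hL : l₀ ≤ L := Real.log_le_log (by linarith) hcV
    have hLpos := hl₀pos.trans_le hL
    have hVΛ : 0 < Fintype.card V * Λ := by positivity
    set p := (Fintype.card V * Λ) ^ (1 / 3 : ℝ) with hpdef
    set q := ε ^ (1 / 3 : ℝ) with hqdef
    have hp : 0 < p := by positivity
    have hq : 0 < q := by positivity
    have hp3 : p ^ 3 = Fintype.card V * Λ := by
      rw [hpdef, ← Real.rpow_natCast, ← Real.rpow_mul hVΛ.le]
      norm_num
    have hq3 : q ^ 3 = ε := by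
      rw [hqdef, ← Real.rpow_natCast, ← Real.rpow_mul hε.le]
      norm_num
    have hp2 : (Fintype.card V * Λ) ^ (2 / 3 : ℝ) = p ^ 2 := by
      rw [hpdef, ← Real.rpow_natCast, ← Real.rpow_mul hVΛ.le]
      norm_num
    have hpq3 : (p * q) ^ 3 = Fintype.card V * Λ * ε := by rw [mul_pow, hp3, hq3]
    -- This is where `1 / V < Λ * ε` enters.
    have hpq : 1 ≤ p * q := by
      by_contra! h
      have h1 : (p * q) ^ 3 < 1 := pow_lt_one₀ (by positivity) h (by norm_num)
      rw [hpq3, mul_assoc] at h1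
      rw [div_lt_iff₀' hV] at hlow
      linarith
    obtain ⟨A, hA, hpriv, hrel⟩ := exists_kernel_laplace G (L := L) hγ hΛ hp hq hp3.symm hLpos.le hpq
      (by rw [hpq3, hLdef, Real.exp_log (by positivity)]; field_simp)
    refine ⟨A, hA, hq3 ▸ hpriv, hrel.mono ?_⟩
    rw [hp2, Real.rpow_neg hε.le, ← hqdef, ← div_eq_mul_inv]
    have h1 : 2 * L + 6 ≤ (2 + 6 / l₀) * L := by
      have : 1 ≤ L / l₀ := (one_le_div hl₀pos).2 hL
      have h2 : (2 + 6 / l₀) * L = 2 * L + 6 * (L / l₀) := by ring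
      linarith
    have h3 : 0 ≤ (√K * B + 4 / (√l₀ * l₀)) * (p ^ 2 / q * L) := by positivity
    calc p ^ 2 / q * (2 * L + 6) ≤ p ^ 2 / q * ((2 + 6 / l₀) * L) := by gcongr
      _ = (2 + 6 / l₀) * (p ^ 2 / q * L) := by ring
      _ ≤ _ := by linarith
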